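/- Let $n\ge 1$. An $n$-qubit measure-and-prepare (m-p) channel is a linear map $A\mapsto\sum_\mu a_\mu\,\mathrm{Tr}[E_\mu A]\,\rho_\mu$ on $n$-qubit operators, where $\{E_\mu\}$ is a finite POVM, $a_\mu\in\{+1,-1\}$ and the $\rho_\mu$ are $n$-qubit density operators. Two orthonormal bases $\{|\phi_i\rangle\}$, $\{|\psi_j\rangle\}$ of the $n$-qubit space are mutually unbiased if $|\langle\phi_i|\psi_j\rangle|^2=2^{-n}$ for all $i,j$. (a) Let $U_1,\dots,U_{2^n}$ be $n$-qubit unitary operators such that $U_1,\dots,U_{2^n},I^{\otimes n}$ map the computational basis $\{|\boldsymbol j\rangle\}_{\boldsymbol j\in\{0,1\}^n}$ to $2^n+1$ pairwise mutually unbiased bases. Then for every $n$-qubit operator $A$ $$A=\sum_{i=1}^{2^n}\sum_{\boldsymbol j\in\{0,1\}^n}\mathrm{Tr}\big[U_i|\boldsymbol j\rangle\langle\boldsymbol j|U_i^\dagger A\big]\,U_i|\boldsymbol j\rangle\langle\boldsymbol j|U_i^\dagger-(2^n-1)\sum_{\boldsymbol j\in\{0,1\}^n}\mathrm{Tr}\big[|\boldsymbol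 j\rangle\langle\boldsymbol j|A\big]\,\rho_{\boldsymbol j},\qquad \rho_{\boldsymbol j}=\sum_{\boldsymbol k\in\{0,1\}^n}\frac{1-\delta_{\boldsymbol j,\boldsymbol k}}{2^n-1}|\boldsymbol k\rangle\langle\boldsymbol k| .$$ This expresses the $n$-qubit identity channel as a linear combination $\sum_i c_i\mathcal E_i$ of $2^n+1$ (distinct) m-p channels $\mathcal E_i$, with coefficients $c_i=1$ for $1\le i\le 2^n$ and $c_{2^n+1}=-(2^n-1)$, so that $\gamma=\sum_i|c_i|=2^{n+1}-1$. (b) Unitary operators $U_1,\dots,U_{2^n}$ as in (a) exist such that, moreover, each $U_i$ is a Clifford operator (it conjugates every Pauli string to a Pauli string up to a phase) and is implemented exactly, without ancilla qubits, by a circuit of depth at most $n+2$ consisting of $H$, $S$, $S^\dagger$ gates on single qubits and $CZ$ gates between arbitrary pairs of qubits. Here the depth is the number of layers, a layer being a collection of gates acting on pairwise disjoint sets of qubits. -/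

import Mathlib

open scoped ComplexOrder Matrix

namespace WireCut

/-- Labels `j ∈ {0,1}ⁿ` of the computational basis of `n` qubits. -/
abbrev Bits (n : ℕ) : Type := Fin n → Fin 2

/-- Operators on the `n`-qubit space, as matrices in the computational basis. -/
abbrev Op (n : ℕ) : Type := Matrix (Bits n) (Bits n) ℂ

/-- The `n`-qubit unitary operators. -/
abbrev UOp (n : ℕ) : Type := Matrix.unitaryGroup (Bits n) ℂ

/-- The projector `|j⟩⟨j|` onto a computational basis state. -/
def ketbra {n : ℕ} (j : Bits n) : Op n := Matrix.single j j 1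

/-- The projector `U|j⟩⟨j|U†`. -/
def rotKetbra {n : ℕ} (U : UOp n) (j : Bits n) : Op n :=
  (U : Op n) * ketbra j * (U : Op n)ᴴ

/-- `ρ_j = ∑_k (1 - δ_{jk}) / (2ⁿ - 1) |k⟩⟨k|`. -/
noncomputable def rhoOther {n : ℕ} (j : Bits n) : Op n :=
  ∑ k : Bits n, ((1 / ((2 : ℂ) ^ n - 1)) * (1 - if j = k then 1 else 0)) • ketbra k

/-! ### Measure-and-prepare channels and quasiprobability decompositions -/

/-- The linear map `A ↦ ∑_μ a_μ Tr[E_μ A] ρ_μ`. -/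
noncomputable def mpMap {n : ℕ} {κ : Type} [Fintype κ] (a : κ → ℝ) (E ρ : κ → Op n) :
    Op n →ₗ[ℂ] Op n where
  toFun A := ∑ μ, ((a μ : ℂ) * (E μ * A).trace) • ρ μ
  map_add' A B := by
    simp only [Matrix.trace_add, mul_add, add_smul, Finset.sum_add_distrib]
  map_smul' c A := by
    simp only [Matrix.mul_smul, Matrix.trace_smul, smul_eq_mul, RingHom.id_apply,
      Finset.smul_sum, smul_smul, mul_left_comm]

/-- A finite-outcome POVM. -/
def IsPOVM {n : ℕ} {κ : Type} [Fintype κ] (E : κ → Op n) : Prop :=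
  (∀ μ, (E μ).PosSemidef) ∧ ∑ μ, E μ = 1

/-- A density operator. -/
def IsDensity {n : ℕ} (ρ : Op n) : Prop := ρ.PosSemidef ∧ ρ.trace = 1

/-- `Φ` is an (extended) measure-and-prepare channel: measure a POVM, multiply the result by a
sign depending on the outcome, and prepare a density operator depending on the outcome. -/
def IsMPChannel {n : ℕ} (Φ : Op n →ₗ[ℂ] Op n) : Prop :=
  ∃ (κ : Type) (_ : Fintype κ) (a : κ → ℝ) (E ρ : κ → Op n),
    (∀ μ, a μ = 1 ∨ a μ = -1) ∧ IsPOVM E ∧ (∀ μ, IsDensity (ρ μ)) ∧ Φ = mpMap a E ρ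

/-- `Γ = ∑_i c_i 𝓔_i` with real coefficients `c_i` and measure-and-prepare channels `𝓔_i`. -/
def IsQuasiprobDecomposition {n m : ℕ} (Γ : Op n →ₗ[ℂ] Op n) (c : Fin m → ℝ)
    (Φ : Fin m → (Op n →ₗ[ℂ] Op n)) : Prop :=
  (∀ i, IsMPChannel (Φ i)) ∧ Γ = ∑ i, (c i : ℂ) • Φ i

/-- `γ = ∑_i |c_i|` of a quasiprobability decomposition. -/
def gamma {m : ℕ} (c : Fin m → ℝ) : ℝ := ∑ i, |c i|

/-- Measure in the basis `U|j⟩` and prepare the observed basis state. -/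
noncomputable def basisChannel {n : ℕ} (U : UOp n) : Op n →ₗ[ℂ] Op n :=
  mpMap (fun _ : Bits n => 1) (rotKetbra U) (rotKetbra U)

/-- Measure in the computational basis and prepare `ρ_j` on outcome `j`. -/
noncomputable def otherChannel (n : ℕ) : Op n →ₗ[ℂ] Op n :=
  mpMap (fun _ : Bits n => 1) ketbra rhoOther

/-- The `2ⁿ + 1` channels of the decomposition. -/
noncomputable def cutChannels {n : ℕ} (U : Fin (2 ^ n) → UOp n) :
    Fin (2 ^ n + 1) → (Op n →ₗ[ℂ] Op n) :=
  Fin.snoc (α := fun _ => Op n →ₗ[ℂ] Op n) (fun i => basisChannel (U i)) (otherChannel n)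

/-- The `2ⁿ + 1` coefficients of the decomposition. -/
def cutCoeffs (n : ℕ) : Fin (2 ^ n + 1) → ℝ :=
  Fin.snoc (α := fun _ => ℝ) (fun _ => 1) (-((2 : ℝ) ^ n - 1))

/-! ### Mutually unbiased bases -/

/-- The image `U|j⟩` of the computational basis state `|j⟩`. -/
noncomputable def basisVec {n : ℕ} (U : UOp n) (j : Bits n) : EuclideanSpace ℂ (Bits n) :=
  WithLp.toLp 2 ((U : Op n) *ᵥ Pi.single j 1)

/-- Two orthonormal bases (each indexed by `{0,1}ⁿ`) are mutually unbiased. -/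
def MutuallyUnbiased {n : ℕ} (φ ψ : Bits n → EuclideanSpace ℂ (Bits n)) : Prop :=
  Orthonormal ℂ φ ∧ Orthonormal ℂ ψ ∧ ∀ i j, ‖inner ℂ (φ i) (ψ j)‖ ^ 2 = 1 / (2 : ℝ) ^ n

/-- The unitaries `U_1, …, U_{2ⁿ}, I` map the computational basis to `2ⁿ + 1` bases which are
pairwise mutually unbiased. -/
def MapsToMUBs {n : ℕ} (U : Fin (2 ^ n) → UOp n) : Prop :=
  Pairwise fun i k : Fin (2 ^ n + 1) =>
    MutuallyUnbiased (basisVec (Fin.snoc (α := fun _ => UOp n) U 1 i))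
      (basisVec (Fin.snoc (α := fun _ => UOp n) U 1 k))

/-! ### Clifford circuits on fully connected qubits -/

/-- The Pauli matrices `I, X, Y, Z`. -/
def pauli : Fin 4 → Matrix (Fin 2) (Fin 2) ℂ :=
  ![!![1, 0; 0, 1], !![0, 1; 1, 0], !![0, -Complex.I; Complex.I, 0], !![1, 0; 0, -1]]

/-- The Pauli string `P_{s 0} ⊗ ⋯ ⊗ P_{s (n-1)}`. -/
def pauliString {n : ℕ} (s : Fin n → Fin 4) : Op n :=
  Matrix.of fun x y => ∏ q, pauli (s q) (x q) (y q)

/-- Clifford operators: unitaries which conjugate every Pauli string to a Pauli string up to a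
phase in `{±1, ±i}`. -/
def IsClifford {n : ℕ} (V : UOp n) : Prop :=
  ∀ s : Fin n → Fin 4, ∃ (t : Fin n → Fin 4) (p : ℂ), p ^ 4 = 1 ∧
    (V : Op n) * pauliString s * (V : Op n)ᴴ = p • pauliString t

/-- The operator which applies the single-qubit operator `g` to qubit `q`. -/
def onQubit {n : ℕ} (g : Matrix (Fin 2) (Fin 2) ℂ) (q : Fin n) : Op n :=
  Matrix.of fun x y => if ∀ k, k ≠ q → x k = y k then g (x q) (y q) else 0

/-- Elementary Clifford gates: Hadamard, phase gate, inverse phase gate on any qubit, and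
controlled-`Z` between any two distinct qubits (full connectivity). -/
inductive Gate (n : ℕ) : Type
  | H (q : Fin n) : Gate n
  | S (q : Fin n) : Gate n
  | Sdg (q : Fin n) : Gate n
  | CZ (q r : Fin n) (hqr : q ≠ r) : Gate n

/-- The qubits on which a gate acts. -/
def Gate.support {n : ℕ} : Gate n → Finset (Fin n)
  | .H q => {q}
  | .S q => {q}
  | .Sdg q => {q}
  | .CZ q r _ => {q, r}

/-- The operator of a gate. -/
noncomputable def Gate.toOp {n : ℕ} : Gate n → Op n
  | .H q => onQubit (((1 / Real.sqrt 2 : ℝ) : ℂ) • !![1, 1; 1, -1]) q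
  | .S q => onQubit !![1, 0; 0, Complex.I] q
  | .Sdg q => onQubit !![1, 0; 0, -Complex.I] q
  | .CZ q r _ => Matrix.diagonal fun x => if x q = 1 ∧ x r = 1 then -1 else 1

/-- A circuit layer: gates acting on pairwise disjoint sets of qubits, performed in parallel. -/
structure Layer (n : ℕ) : Type where
  gates : List (Gate n)
  disjoint : gates.Pairwise fun g h => Disjoint g.support h.support

/-- The operator of a layer. -/
noncomputable def Layer.toOp {n : ℕ} (L : Layer n) : Op n := (L.gates.map Gate.toOp).prod

/-- A circuit of elementary Clifford gates without ancilla qubits: a list of layers, the head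
being performed first. -/
abbrev Circuit (n : ℕ) : Type := List (Layer n)

/-- The operator of a circuit. -/
noncomputable def Circuit.toOp {n : ℕ} : Circuit n → Op n
  | [] => 1
  | L :: C => Circuit.toOp C * L.toOp

/-- The depth of a circuit is its number of layers. -/
def Circuit.depth {n : ℕ} (C : Circuit n) : ℕ := List.length C

/-- `U` is exactly implemented by a Clifford circuit of depth at most `d` on fully connected
qubits. -/
def HasCliffordCircuit {n : ℕ} (U : UOp n) (d : ℕ) : Prop :=
  IsClifford U ∧ ∃ C : Circuit n, Circuit.depth C ≤ d ∧ Circuit.toOp C = (U : Op n)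

end WireCut

/-! Part (a) is the 2-design property of a complete set of mutually unbiased bases: with d = 2ⁿ and
P running over all d(d + 1) basis projectors, ∑ Tr[PA] P = A + Tr[A]·1. Both sides are linear in A,
so a spanning set suffices, and the projectors themselves span (`span_mub_projectors_eq_top`). On a
projector P the basis containing it returns P, while each of the d other bases returns 1/d
(`sum_trace_smul_mub_projectors`). Moving Tr[A]·1 and the computational-basis terms to the other
side produces the term with the states ρ_j.

For part (b) take U = D_f H^{⊗n}, where D_f is diagonal and f is a phase on 𝔽₂ⁿ whose polarization
is a symmetric matrix M. Overlaps of two such bases are quadratic Gauss sums with form M + M', and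
these have constant modulus when M + M' is nonsingular (`IsQuadPhase.norm_sq_sum`). The matrices
Tr(a b_p b_q), for a in 𝔽_{2ⁿ} and (b_p) a basis over 𝔽₂, supply 2ⁿ such M
(`exists_symmetric_spread`). The phase f is a product of S gates (diagonal of M) and CZ gates
(off-diagonal pairs). Colouring the pair {a, b} by a + b mod n splits the CZ gates into n layers,
whence depth n + 2. -/

namespace WireCut

/-! ### Complete sets of mutually unbiased bases as 2-designs -/

section Design

variable {β κ : Type*} [Fintype β] [DecidableEq β] [Fintype κ] [DecidableEq κ]

/-- Projectors onto the members of a complete set of mutually unbiased bases span the operators. -/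
theorem span_mub_projectors_eq_top (hcard : Fintype.card β = Fintype.card κ + 1)
    (k₀ : κ) (P : β → κ → Matrix κ κ ℂ) (hsum : ∀ b, ∑ j, P b j = 1)
    (hself : ∀ b j k, (P b j * P b k).trace = if j = k then 1 else 0)
    (hcross : ∀ b c, b ≠ c → ∀ j k, (P b j * P c k).trace = (Fintype.card κ : ℂ)⁻¹) :
    Submodule.span ℂ (Set.range fun p : β × κ => P p.1 p.2) = ⊤ := by
  have htr : ∀ b j, (P b j).trace = 1 := by
    intro b j
    have := congrArg Matrix.trace (congrArg (P b j * ·) (hsum b))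
    simp only [Finset.mul_sum, Matrix.trace_sum, hself, mul_one] at this
    simpa using this.symm
  -- Every basis sums to 1, so one projector per basis is redundant once the identity is included.
  -- This leaves 1 + (d + 1)(d - 1) = d² matrices, exactly the dimension, so linear independence
  -- suffices.
  let v : Option (β × {j : κ // j ≠ k₀}) → Matrix κ κ ℂ :=
    fun o => o.elim 1 fun p => P p.1 p.2
  have hli : LinearIndependent ℂ v := by
    rw [Fintype.linearIndependent_iff]
    intro g hg
    rw [Fintype.sum_option, Fintype.sum_prod_type] at hg
    simp only [v, Option.elim] at hg
    -- Pair the linear relation with `P c k` under the trace form.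
    have key : ∀ c k, g none + ∑ b, ∑ j : {j : κ // j ≠ k₀},
        g (some (b, j)) * (if b = c then (if (j : κ) = k then 1 else 0)
          else (Fintype.card κ : ℂ)⁻¹) = 0 := by
      intro c k
      have h := congrArg Matrix.trace (congrArg (· * P c k) hg)
      simp only [add_mul, Finset.sum_mul, Matrix.trace_add, Matrix.trace_sum, Matrix.smul_mul,
        Matrix.trace_smul, smul_eq_mul, one_mul, htr, mul_one, zero_mul, Matrix.trace_zero] at h
      refine Eq.trans ?_ h
      congr 1
      refine Finset.sum_congr rfl fun b _ => Finset.sum_congr rfl fun j _ => ?_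
      by_cases hb : b = c
      · subst hb; simp [hself]
      · simp [hb, hcross b c hb]
    have hsome : ∀ c (k : {j : κ // j ≠ k₀}), g (some (c, k)) = 0 := by
      intro c k
      have h1 := key c k
      have h2 := key c k₀
      rw [← Finset.add_sum_erase _ _ (Finset.mem_univ c)] at h1 h2
      -- The contribution of the other bases does not depend on `k'`. Since `k₀` is absent from the
      -- family, subtracting the relation at `k₀` from the one at `k` isolates the coefficient of `P
      -- c k`.
      have h3 : ∀ k' : κ, ∑ b ∈ Finset.univ.erase c, ∑ j : {j : κ // j ≠ k₀},
          g (some (b, j)) * (if b = c then (if (j : κ) = k' then 1 else 0)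
            else (Fintype.card κ : ℂ)⁻¹) = ∑ b ∈ Finset.univ.erase c,
              ∑ j : {j : κ // j ≠ k₀}, g (some (b, j)) * (Fintype.card κ : ℂ)⁻¹ := by
        intro k'
        refine Finset.sum_congr rfl fun b hb => Finset.sum_congr rfl fun j _ => ?_
        rw [if_neg (Finset.ne_of_mem_erase hb)]
      rw [h3] at h1 h2
      have h4 : ∑ j : {j : κ // j ≠ k₀}, g (some (c, j)) *
          (if c = c then (if (j : κ) = k₀ then 1 else 0) else (Fintype.card κ : ℂ)⁻¹) = 0 :=
        Finset.sum_eq_zero fun j _ => by simp [j.2]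
      have h5 : ∑ j : {j : κ // j ≠ k₀}, g (some (c, j)) *
          (if c = c then (if (j : κ) = k then 1 else 0) else (Fintype.card κ : ℂ)⁻¹)
            = g (some (c, k)) := by
        simp [Subtype.coe_inj]
      rw [h4] at h2
      rw [h5] at h1
      linear_combination h1 - h2
    have hnone : g none = 0 := by
      simp only [hsome, zero_smul, Finset.sum_const_zero, add_zero] at hg
      have := congrFun (congrFun hg k₀) k₀
      simpa using this
    rintro (_ | ⟨c, k⟩)
    · exact hnone
    · exact hsome c k
  have hc : Fintype.card (Option (β × {j : κ // j ≠ k₀})) =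
      Module.finrank ℂ (Matrix κ κ ℂ) := by
    have : 1 ≤ Fintype.card κ := Fintype.card_pos_iff.2 ⟨k₀⟩
    rw [Module.finrank_matrix, Fintype.card_option, Fintype.card_prod, hcard,
      Fintype.card_subtype_compl, Fintype.card_subtype_eq, Module.finrank_self]
    obtain ⟨m, hm⟩ := Nat.exists_eq_add_of_le this
    rw [hm, Nat.add_sub_cancel_left]
    ring
  have htop := hli.span_eq_top_of_card_eq_finrank' hc
  rw [eq_top_iff, ← htop, Submodule.span_le]
  rintro _ ⟨(_ | ⟨b, j⟩), rfl⟩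
  · have hb : Nonempty β := Fintype.card_pos_iff.1 (by omega)
    simp only [v, Option.elim, SetLike.mem_coe]
    rw [← hsum hb.some]
    exact Submodule.sum_mem _ fun j _ => Submodule.subset_span ⟨(hb.some, j), rfl⟩
  · exact Submodule.subset_span ⟨(b, (j : κ)), rfl⟩

/-- A complete set of mutually unbiased bases is a complex projective 2-design. -/
theorem sum_trace_smul_mub_projectors (hcard : Fintype.card β = Fintype.card κ + 1)
    (k₀ : κ) (P : β → κ → Matrix κ κ ℂ) (hsum : ∀ b, ∑ j, P b j = 1)
    (hself : ∀ b j k, (P b j * P b k).trace = if j = k then 1 else 0)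
    (hcross : ∀ b c, b ≠ c → ∀ j k, (P b j * P c k).trace = (Fintype.card κ : ℂ)⁻¹)
    (A : Matrix κ κ ℂ) :
    ∑ b, ∑ j, (P b j * A).trace • P b j = A + A.trace • 1 := by
  have hA : A ∈ Submodule.span ℂ (Set.range fun p : β × κ => P p.1 p.2) := by
    rw [span_mub_projectors_eq_top hcard k₀ P hsum hself hcross]
    trivial
  have hd : (Fintype.card κ : ℂ) ≠ 0 := by
    have : Fintype.card κ ≠ 0 := (Fintype.card_pos_iff.2 ⟨k₀⟩).ne'
    exact_mod_cast this
  induction hA using Submodule.span_induction with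
  | zero => simp
  | add x y _ _ hx hy =>
    simp only [mul_add, Matrix.trace_add, add_smul, Finset.sum_add_distrib, hx, hy]
    abel
  | smul a x _ hx =>
    simp only [Matrix.mul_smul, Matrix.trace_smul, smul_eq_mul, mul_smul, ← Finset.smul_sum, hx,
      smul_add]
  | mem x hx =>
    obtain ⟨⟨c, k⟩, rfl⟩ := hx
    have htr : (P c k).trace = 1 := by
      have := congrArg Matrix.trace (congrArg (P c k * ·) (hsum c))
      simp only [Finset.mul_sum, Matrix.trace_sum, hself, mul_one] at this
      simpa using this.symm
    have h1 : ∑ j, (P c j * P c k).trace • P c j = P c k := by simp [hself]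
    have h2 : ∀ b ∈ Finset.univ.erase c, ∑ j, (P b j * P c k).trace • P b j =
        (Fintype.card κ : ℂ)⁻¹ • (1 : Matrix κ κ ℂ) := by
      intro b hb
      simp only [hcross b c (Finset.ne_of_mem_erase hb), ← Finset.smul_sum, hsum]
    rw [← Finset.add_sum_erase _ _ (Finset.mem_univ c)]
    simp only [h1]
    rw [Finset.sum_congr rfl h2, Finset.sum_const, Finset.card_erase_of_mem (Finset.mem_univ c),
      Finset.card_univ, hcard, Nat.add_sub_cancel, ← Nat.cast_smul_eq_nsmul ℂ, smul_smul,
      mul_inv_cancel₀ hd, htr]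

end Design

/-! ### The identity channel and the distinctness of the channels -/

variable {n : ℕ}

theorem card_bits (n : ℕ) : Fintype.card (Bits n) = 2 ^ n := by simp

theorem inner_basisVec (U W : UOp n) (i j : Bits n) :
    inner ℂ (basisVec U i) (basisVec W j) = ((U : Op n)ᴴ * (W : Op n)) i j := by
  simp [basisVec, Matrix.mul_apply, PiLp.inner_apply, mul_comm]

theorem orthonormal_basisVec (U : UOp n) : Orthonormal ℂ (basisVec U) := by
  rw [orthonormal_iff_ite]
  intro i j
  rw [inner_basisVec, ← Matrix.star_eq_conjTranspose, Matrix.UnitaryGroup.star_mul_self,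
    Matrix.one_apply]

theorem trace_rotKetbra_mul (U : UOp n) (j : Bits n) (A : Op n) :
    (rotKetbra U j * A).trace = ((U : Op n)ᴴ * A * U) j j := by
  rw [rotKetbra, mul_assoc, mul_assoc, Matrix.trace_mul_comm, mul_assoc]
  simp only [ketbra, Matrix.trace_single_mul, one_smul]

theorem trace_rotKetbra_mul_rotKetbra (U W : UOp n) (i j : Bits n) :
    (rotKetbra U i * rotKetbra W j).trace
      = ((‖inner ℂ (basisVec U i) (basisVec W j)‖ ^ 2 : ℝ) : ℂ) := by
  rw [trace_rotKetbra_mul, inner_basisVec, rotKetbra]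
  have : (U : Op n)ᴴ * ((W : Op n) * ketbra j * (W : Op n)ᴴ) * (U : Op n)
      = ((U : Op n)ᴴ * (W : Op n)) * ketbra j * ((U : Op n)ᴴ * (W : Op n))ᴴ := by
    simp only [Matrix.conjTranspose_mul, Matrix.conjTranspose_conjTranspose, mul_assoc]
  rw [this, Matrix.mul_apply, Finset.sum_eq_single j]
  · rw [ketbra, Matrix.mul_single_apply_same, Matrix.conjTranspose_apply, mul_one, Complex.ofReal_pow,
      ← Complex.mul_conj']
    rfl
  · intro b _ hb
    rw [ketbra, Matrix.mul_single_apply_of_ne _ _ _ _ _ hb, zero_mul]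
  · simp

theorem sum_ketbra (n : ℕ) : ∑ j : Bits n, ketbra j = 1 := by
  simp only [ketbra, ← Matrix.diagonal_single]
  ext i k
  simp [Matrix.sum_apply, Matrix.diagonal_apply, Matrix.one_apply, Pi.single_apply]

theorem sum_rotKetbra (U : UOp n) : ∑ j, rotKetbra U j = 1 := by
  simp only [rotKetbra, ← Finset.sum_mul, ← Finset.mul_sum, sum_ketbra, mul_one]
  exact Matrix.mem_unitaryGroup_iff.1 U.2

theorem trace_rotKetbra_mul_self (U : UOp n) (i j : Bits n) :
    (rotKetbra U i * rotKetbra U j).trace = if i = j then 1 else 0 := by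
  rw [trace_rotKetbra_mul_rotKetbra, orthonormal_iff_ite.1 (orthonormal_basisVec U)]
  split_ifs <;> simp

theorem trace_rotKetbra (U : UOp n) (j : Bits n) : (rotKetbra U j).trace = 1 := by
  have := congrArg (fun A => (rotKetbra U j * A).trace) (sum_rotKetbra U)
  simp only [Finset.mul_sum, Matrix.trace_sum, trace_rotKetbra_mul_self, mul_one] at this
  simpa using this.symm

theorem rotKetbra_one (j : Bits n) : rotKetbra 1 j = ketbra j := by simp [rotKetbra]

theorem posSemidef_ketbra (j : Bits n) : (ketbra j).PosSemidef := by
  rw [ketbra, ← Matrix.diagonal_single, Matrix.posSemidef_diagonal_iff]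
  intro i
  by_cases h : i = j
  · subst h; simp
  · simp [h]

theorem posSemidef_rotKetbra (U : UOp n) (j : Bits n) : (rotKetbra U j).PosSemidef :=
  (posSemidef_ketbra j).mul_mul_conjTranspose_same _

theorem MapsToMUBs.trace_cross {U : Fin (2 ^ n) → UOp n} (hU : MapsToMUBs U)
    (b c : Fin (2 ^ n + 1)) (h : b ≠ c) (j k : Bits n) :
    (rotKetbra (Fin.snoc (α := fun _ => UOp n) U 1 b) j
      * rotKetbra (Fin.snoc (α := fun _ => UOp n) U 1 c) k).trace
      = (Fintype.card (Bits n) : ℂ)⁻¹ := by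
  rw [trace_rotKetbra_mul_rotKetbra, (hU h).2.2 j k, card_bits]
  simp

theorem two_pow_sub_one_ne_zero (hn : 1 ≤ n) : (2 : ℂ) ^ n - 1 ≠ 0 := by
  have h : (1 : ℝ) < 2 ^ n := one_lt_pow₀ one_lt_two (by omega)
  have h' : (2 : ℝ) ^ n - 1 ≠ 0 := by linarith
  exact_mod_cast h'

theorem rhoOther_eq (j : Bits n) :
    rhoOther j = (1 / ((2 : ℂ) ^ n - 1)) • (1 - ketbra j) := by
  simp only [rhoOther, mul_smul, ← Finset.smul_sum, sub_smul, one_smul, Finset.sum_sub_distrib,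
    sum_ketbra]
  simp

/-- The design identity differs from the identity map by an excess Tr[A]·1 and the dephasing of A in
the computational basis. Because ρ_j is proportional to 1 - |j⟩⟨j|, one channel with a negative
coefficient corrects both. -/
theorem sum_trace_smul_rhoOther (hn : 1 ≤ n) (A : Op n) :
    ((2 : ℂ) ^ n - 1) • ∑ j : Bits n, (ketbra j * A).trace • rhoOther j
      = A.trace • 1 - ∑ j : Bits n, (ketbra j * A).trace • ketbra j := by
  have h : ∑ j : Bits n, (ketbra j * A).trace = A.trace := by
    rw [← Matrix.trace_sum, ← Finset.sum_mul, sum_ketbra, one_mul]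
  simp only [rhoOther_eq, smul_comm _ (1 / ((2 : ℂ) ^ n - 1)), ← Finset.smul_sum]
  rw [smul_smul, one_div_mul_cancel (two_pow_sub_one_ne_zero hn), one_smul]
  simp only [smul_sub, Finset.sum_sub_distrib, ← Finset.sum_smul, h]

/-- The decomposition of the identity by measurements in mutually unbiased bases. -/
theorem MapsToMUBs.identity_eq (hn : 1 ≤ n) {U : Fin (2 ^ n) → UOp n} (hU : MapsToMUBs U)
    (A : Op n) :
    A = (∑ i, ∑ j, (rotKetbra (U i) j * A).trace • rotKetbra (U i) j)
      - ((2 : ℂ) ^ n - 1) • ∑ j : Bits n, (ketbra j * A).trace • rhoOther j := by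
  have h := sum_trace_smul_mub_projectors (by rw [card_bits, Fintype.card_fin]) (0 : Bits n)
    (fun b j => rotKetbra (Fin.snoc (α := fun _ => UOp n) U 1 b) j)
    (fun b => sum_rotKetbra _) (fun b => trace_rotKetbra_mul_self _) hU.trace_cross A
  rw [Fin.sum_univ_castSucc] at h
  simp only [Fin.snoc_castSucc, Fin.snoc_last, rotKetbra_one] at h
  rw [sum_trace_smul_rhoOther hn, sub_sub_eq_add_sub, h, add_sub_cancel_right]

theorem mpMap_apply {κ : Type} [Fintype κ] (a : κ → ℝ) (E ρ : κ → Op n) (A : Op n) :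
    mpMap a E ρ A = ∑ μ, ((a μ : ℂ) * (E μ * A).trace) • ρ μ := rfl

theorem isMPChannel_basisChannel (U : UOp n) : IsMPChannel (basisChannel U) :=
  ⟨Bits n, inferInstance, _, _, _, fun _ => Or.inl rfl,
    ⟨posSemidef_rotKetbra U, sum_rotKetbra U⟩,
    fun j => ⟨posSemidef_rotKetbra U j, trace_rotKetbra U j⟩, rfl⟩

theorem isDensity_rhoOther (hn : 1 ≤ n) (j : Bits n) : IsDensity (rhoOther j) := by
  constructor
  · rw [rhoOther]
    refine Matrix.posSemidef_sum _ fun k _ => (posSemidef_ketbra k).smul ?_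
    have h : (0 : ℝ) ≤ 1 / ((2 : ℝ) ^ n - 1) * (1 - if j = k then 1 else 0) := by
      have h1 : (1 : ℝ) ≤ 2 ^ n := one_le_pow₀ one_le_two
      refine mul_nonneg (one_div_nonneg.2 (by linarith)) ?_
      split_ifs <;> simp
    have h' := Complex.zero_le_real.2 h
    rwa [Complex.ofReal_mul, Complex.ofReal_sub, apply_ite Complex.ofReal, Complex.ofReal_div,
      Complex.ofReal_sub, Complex.ofReal_pow, Complex.ofReal_one, Complex.ofReal_zero,
      Complex.ofReal_ofNat] at h'
  · have h : (ketbra j).trace = 1 := by simp [ketbra]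
    rw [rhoOther_eq, Matrix.trace_smul, Matrix.trace_sub, h, Matrix.trace_one, card_bits,
      smul_eq_mul]
    push_cast
    exact one_div_mul_cancel (two_pow_sub_one_ne_zero hn)

theorem isMPChannel_otherChannel (hn : 1 ≤ n) : IsMPChannel (otherChannel n) :=
  ⟨Bits n, inferInstance, _, _, _, fun _ => Or.inl rfl,
    ⟨posSemidef_ketbra, sum_ketbra n⟩, isDensity_rhoOther hn, rfl⟩

theorem cutChannels_castSucc (U : Fin (2 ^ n) → UOp n) (i : Fin (2 ^ n)) :
    cutChannels U i.castSucc = basisChannel (U i) := by simp [cutChannels]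

theorem cutChannels_last (U : Fin (2 ^ n) → UOp n) :
    cutChannels U (Fin.last _) = otherChannel n := by simp [cutChannels]

theorem basisChannel_apply_rotKetbra (U : UOp n) (j : Bits n) :
    basisChannel U (rotKetbra U j) = rotKetbra U j := by
  simp [basisChannel, mpMap_apply, trace_rotKetbra_mul_self]

/-- Measured in an unbiased basis, a basis state gives a uniform outcome, and the uniform average of
the prepared states is maximally mixed, also for the ρ_j. The state's own channel fixes it, which
tells the channels apart. -/
theorem MapsToMUBs.cutChannels_apply_rotKetbra (hn : 1 ≤ n) {U : Fin (2 ^ n) → UOp n}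
    (hU : MapsToMUBs U) (i : Fin (2 ^ n)) (k : Fin (2 ^ n + 1)) (h : i.castSucc ≠ k)
    (j : Bits n) :
    cutChannels U k (rotKetbra (U i) j) = (Fintype.card (Bits n) : ℂ)⁻¹ • 1 := by
  have hc := fun l => hU.trace_cross k i.castSucc h.symm l j
  rw [Fin.snoc_castSucc] at hc
  induction k using Fin.lastCases with
  | cast k =>
    rw [Fin.snoc_castSucc] at hc
    rw [cutChannels_castSucc, basisChannel, mpMap_apply]
    simp only [hc, Complex.ofReal_one, one_mul, ← Finset.smul_sum, sum_rotKetbra]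
  | last =>
    simp only [Fin.snoc_last, rotKetbra_one] at hc
    rw [cutChannels_last, otherChannel, mpMap_apply]
    have h2 := sum_trace_smul_rhoOther hn (rotKetbra (U i) j)
    simp only [hc, trace_rotKetbra, ← Finset.smul_sum, sum_ketbra] at h2
    simp only [hc, Complex.ofReal_one, one_mul, ← Finset.smul_sum]
    have h3 : (1 : ℂ) • (1 : Op n) - (Fintype.card (Bits n) : ℂ)⁻¹ • (1 : Op n)
        = ((2 : ℂ) ^ n - 1) • (Fintype.card (Bits n) : ℂ)⁻¹ • 1 := by
      rw [smul_smul, ← sub_smul, card_bits]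
      congr 1
      push_cast
      field_simp
    rw [h3] at h2
    exact smul_right_injective _ (two_pow_sub_one_ne_zero hn) h2

theorem MapsToMUBs.cutChannels_ne (hn : 1 ≤ n) {U : Fin (2 ^ n) → UOp n}
    (hU : MapsToMUBs U) (i : Fin (2 ^ n)) (k : Fin (2 ^ n + 1)) (h : i.castSucc ≠ k) :
    cutChannels U i.castSucc ≠ cutChannels U k := by
  intro heq
  have h1 := hU.cutChannels_apply_rotKetbra hn i k h 0
  rw [← heq, cutChannels_castSucc, basisChannel_apply_rotKetbra] at h1
  -- Compare purities: a pure state has Tr[P²] = 1, the maximally mixed state only 2⁻ⁿ < 1.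
  have h2 := trace_rotKetbra_mul_self (U i) 0 0
  rw [if_pos rfl] at h2
  nth_rw 2 [h1] at h2
  rw [Matrix.mul_smul, mul_one, Matrix.trace_smul, trace_rotKetbra, smul_eq_mul, mul_one,
    inv_eq_one, card_bits, Nat.cast_eq_one] at h2
  exact (Nat.one_lt_two_pow (by omega)).ne' h2

theorem MapsToMUBs.cutChannels_injective (hn : 1 ≤ n) {U : Fin (2 ^ n) → UOp n}
    (hU : MapsToMUBs U) : Function.Injective (cutChannels U) := by
  intro i k
  contrapose!
  intro h
  induction i using Fin.lastCases with
  | cast i => exact hU.cutChannels_ne hn i k h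
  | last =>
    induction k using Fin.lastCases with
    | cast k => exact (hU.cutChannels_ne hn k _ h.symm).symm
    | last => exact absurd rfl h

theorem MapsToMUBs.isQuasiprobDecomposition (hn : 1 ≤ n) {U : Fin (2 ^ n) → UOp n}
    (hU : MapsToMUBs U) :
    IsQuasiprobDecomposition LinearMap.id (cutCoeffs n) (cutChannels U) := by
  constructor
  · intro i
    induction i using Fin.lastCases with
    | cast i => rw [cutChannels_castSucc]; exact isMPChannel_basisChannel _
    | last => rw [cutChannels_last]; exact isMPChannel_otherChannel hn
  · refine LinearMap.ext fun A => ?_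
    rw [Fin.sum_univ_castSucc]
    simp only [cutChannels_castSucc, cutChannels_last, cutCoeffs, Fin.snoc_castSucc, Fin.snoc_last,
      LinearMap.add_apply, LinearMap.sum_apply, LinearMap.smul_apply, LinearMap.id_apply,
      basisChannel, otherChannel, mpMap_apply, Complex.ofReal_one, one_mul, one_smul]
    push_cast
    rw [neg_smul, ← sub_eq_add_neg]
    exact hU.identity_eq hn A

theorem gamma_cutCoeffs (n : ℕ) : gamma (cutCoeffs n) = 2 ^ (n + 1) - 1 := by
  have h : (1 : ℝ) ≤ 2 ^ n := one_le_pow₀ one_le_two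
  rw [gamma, Fin.sum_univ_castSucc]
  simp only [cutCoeffs, Fin.snoc_castSucc, Fin.snoc_last, abs_neg, abs_one, Finset.sum_const,
    Finset.card_univ, Fintype.card_fin, nsmul_eq_mul, mul_one]
  rw [abs_of_nonneg (by linarith)]
  push_cast
  ring

/-! ### Symmetric matrices over 𝔽₂ with nonsingular differences -/

open scoped Fin.CommRing

/-- The multiplication-twisted trace forms of `𝔽_{2ⁿ}` give `2ⁿ` symmetric matrices over `𝔽₂`
with pairwise invertible differences. -/
theorem exists_symmetric_spread_zmod (n : ℕ) (hn : n ≠ 0) :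
    ∃ M : Fin (2 ^ n) → Matrix (Fin n) (Fin n) (ZMod 2), (∀ i, (M i).IsSymm) ∧
      ∀ i k, i ≠ k → ∀ y, (M i + M k) *ᵥ y = 0 → y = 0 := by
  have : Fact (Nat.Prime 2) := ⟨Nat.prime_two⟩
  let F := GaloisField 2 n
  let b := Module.finBasisOfFinrankEq (ZMod 2) F (GaloisField.finrank 2 hn)
  have hcard : Nat.card (Fin (2 ^ n)) = Nat.card F := by
    rw [GaloisField.card 2 n hn, Nat.card_eq_fintype_card, Fintype.card_fin]
  let e : Fin (2 ^ n) ≃ F := (Finite.card_eq.1 hcard).some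
  refine ⟨fun i => Matrix.of fun p q => Algebra.trace (ZMod 2) F (e i * b p * b q), fun i => ?_,
    fun i k hik y hy => ?_⟩
  · ext p q
    simp only [Matrix.transpose_apply, Matrix.of_apply, mul_right_comm]
  -- A kernel vector `y` is the coordinate vector of some z with Tr((a + a') z b_p) = 0 for every p,
  -- where a = `e i` and a' = `e k`. Nondegeneracy of the trace form gives (a + a') z = 0. In
  -- characteristic 2 the factor a + a' vanishes only when a = a'.
  · have hz : (e i + e k) * ∑ q, y q • b q = 0 := by
      refine (traceForm_nondegenerate (ZMod 2) F).1 _ fun z => ?_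
      have hb : (Algebra.traceForm (ZMod 2) F) ((e i + e k) * ∑ q, y q • b q) = 0 := by
        refine b.ext fun p => ?_
        have hp := congrFun hy p
        simp only [Matrix.mulVec, dotProduct, Matrix.add_apply, Matrix.of_apply,
          Pi.zero_apply] at hp
        rw [LinearMap.zero_apply, ← hp, Algebra.traceForm_apply, Finset.mul_sum, Finset.sum_mul,
          map_sum]
        refine Finset.sum_congr rfl fun q _ => ?_
        rw [← map_add (Algebra.trace (ZMod 2) F), ← add_mul, ← add_mul, mul_smul_comm, smul_mul_assoc, map_smul, smul_eq_mul,
          mul_comm (y q), mul_right_comm]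
      rw [hb, LinearMap.zero_apply]
    rcases mul_eq_zero.1 hz with h | h
    · exact absurd (e.injective (CharTwo.add_eq_zero.1 h)) hik
    · exact funext fun q => Fintype.linearIndependent_iff.1 b.linearIndependent y h q

/-- `ZMod 2` reduces to `Fin 2`, the type of the bits, so the statement carries over definitionally.
-/
theorem exists_symmetric_spread (n : ℕ) (hn : n ≠ 0) :
    ∃ M : Fin (2 ^ n) → Matrix (Fin n) (Fin n) (Fin 2), (∀ i, (M i).IsSymm) ∧
      ∀ i k, i ≠ k → ∀ y, (M i + M k) *ᵥ y = 0 → y = 0 :=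
  exists_symmetric_spread_zmod n hn

/-! ### Signs -/

/-- The nontrivial character of `ℤ/2`. -/
def sgn (a : Fin 2) : ℂ := if a = 0 then 1 else -1

@[simp] theorem sgn_zero : sgn 0 = 1 := rfl

theorem sgn_add (a b : Fin 2) : sgn (a + b) = sgn a * sgn b := by
  fin_cases a <;> fin_cases b <;> simp [sgn]

theorem star_sgn (a : Fin 2) : star (sgn a) = sgn a := by
  fin_cases a <;> simp [sgn]

theorem sgn_sum {ι : Type*} (s : Finset ι) (f : ι → Fin 2) :
    sgn (∑ i ∈ s, f i) = ∏ i ∈ s, sgn (f i) := by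
  classical
  induction s using Finset.induction_on with
  | empty => simp
  | insert a s ha ih => rw [Finset.sum_insert ha, Finset.prod_insert ha, sgn_add, ih]

theorem bits_add_self (x : Bits n) : x + x = 0 := by
  funext q
  have : ∀ a : Fin 2, a + a = 0 := by decide
  exact this (x q)

theorem bits_add_eq_zero_iff (x y : Bits n) : x + y = 0 ↔ x = y := by
  constructor
  · intro h
    calc x = x + (y + y) := by rw [bits_add_self, add_zero]
      _ = y := by rw [← add_assoc, h, zero_add]
  · rintro rfl
    exact bits_add_self x

/-- Orthogonality of characters: the sum factors over the qubits into one-bit sums, each equal to 2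
or 0. -/
theorem sum_sgn_dotProduct (v : Bits n) :
    ∑ x : Bits n, sgn (x ⬝ᵥ v) = if v = 0 then 2 ^ n else 0 := by
  have h : ∀ a : Fin 2, ∑ t : Fin 2, sgn (t * a) = if a = 0 then 2 else 0 := by
    intro a
    fin_cases a <;> simp [sgn]
  have h2 := Finset.prod_univ_sum (fun _ : Fin n => (Finset.univ : Finset (Fin 2)))
    (fun q t => sgn (t * v q))
  simp only [h, Fintype.piFinset_univ] at h2
  simp only [dotProduct, sgn_sum, ← h2, Finset.prod_ite_zero, Finset.mem_univ, true_implies,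
    Finset.prod_const, Finset.card_univ, Fintype.card_fin, funext_iff, Pi.zero_apply]

/-! ### Quadratic phases -/

/-- `f` is a phase function whose polarization is the form `B`. -/
structure IsQuadPhase (f : Bits n → ℂ) (B : Matrix (Fin n) (Fin n) (Fin 2)) : Prop where
  map_zero : f 0 = 1
  map_add : ∀ x y, f (x + y) = f x * f y * sgn (x ⬝ᵥ B *ᵥ y)

namespace IsQuadPhase

variable {f g : Bits n → ℂ} {B C : Matrix (Fin n) (Fin n) (Fin 2)}

theorem one : IsQuadPhase (1 : Bits n → ℂ) 0 := ⟨rfl, by simp⟩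

theorem linear (v : Bits n) : IsQuadPhase (fun x => sgn (x ⬝ᵥ v)) 0 :=
  ⟨by simp, fun x y => by simp [add_dotProduct, sgn_add]⟩

theorem mul (hf : IsQuadPhase f B) (hg : IsQuadPhase g C) : IsQuadPhase (f * g) (B + C) := by
  refine ⟨by simp [hf.map_zero, hg.map_zero], fun x y => ?_⟩
  simp only [Pi.mul_apply, hf.map_add, hg.map_add, Matrix.add_mulVec, dotProduct_add, sgn_add]
  ring

theorem prod {ι : Type*} (s : Finset ι) {f : ι → Bits n → ℂ}
    {B : ι → Matrix (Fin n) (Fin n) (Fin 2)} (h : ∀ i, IsQuadPhase (f i) (B i)) :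
    IsQuadPhase (∏ i ∈ s, f i) (∑ i ∈ s, B i) := by
  classical
  induction s using Finset.induction_on with
  | empty => exact one
  | insert a s ha ih =>
    rw [Finset.sum_insert ha, Finset.prod_insert ha]
    exact (h a).mul ih

/-- Signs are real, so conjugation keeps the form. Hence f̄g has form B + C, which is the difference
of the forms in characteristic 2. -/
theorem star (hf : IsQuadPhase f B) : IsQuadPhase (star f) B := by
  refine ⟨by simp [hf.map_zero], fun x y => ?_⟩
  simp only [Pi.star_apply, hf.map_add, star_mul', star_sgn]

/-- Since x + x = 0, polarization at (x, x) gives f(x)² = ±1. -/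
theorem pow_four (hf : IsQuadPhase f B) (x : Bits n) : f x ^ 4 = 1 := by
  have h := hf.map_add x x
  rw [bits_add_self, hf.map_zero] at h
  have h2 : ∀ a : Fin 2, sgn a ^ 2 = 1 := by
    intro a
    fin_cases a <;> simp [sgn]
  calc f x ^ 4 = (f x * f x * sgn (x ⬝ᵥ B *ᵥ x)) ^ 2 := by rw [mul_pow _ (sgn _), h2]; ring
    _ = 1 := by rw [← h, one_pow]

theorem mul_star_self (hf : IsQuadPhase f B) (x : Bits n) : f x * Star.star (f x) = 1 := by
  have h := Complex.norm_eq_one_of_pow_eq_one (hf.pow_four x) (by norm_num)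
  have h2 := Complex.mul_conj' (f x)
  rw [h] at h2
  simpa using h2

/-- A quadratic Gauss sum of a nondegenerate form has absolute value `2 ^ (n / 2)`. -/
theorem norm_sq_sum (hf : IsQuadPhase f B) (hB : ∀ y, B *ᵥ y = 0 → y = 0) :
    ‖∑ x, f x‖ ^ 2 = (2 : ℝ) ^ n := by
  have h : (starRingEnd ℂ) (∑ x, f x) * ∑ x, f x = 2 ^ n := by
    rw [map_sum, Finset.sum_mul]
    have h1 : ∀ z : Bits n, (starRingEnd ℂ) (f z) * ∑ x, f x
        = ∑ y, f y * sgn (z ⬝ᵥ B *ᵥ y) := by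
      intro z
      -- Substituting x = z + y cancels f(z) against its conjugate and leaves a sign that is
      -- bilinear in z and y.
      rw [← Equiv.sum_comp (Equiv.addLeft z), Finset.mul_sum]
      refine Finset.sum_congr rfl fun y _ => ?_
      rw [Equiv.coe_addLeft, hf.map_add]
      have := hf.mul_star_self z
      rw [← starRingEnd_apply] at this
      linear_combination (f y * sgn (z ⬝ᵥ B *ᵥ y)) * this
    simp only [h1]
    -- Summing over z first, orthogonality kills every y with By ≠ 0. By nondegeneracy only y = 0
    -- survives.
    rw [Finset.sum_comm]
    simp only [← Finset.mul_sum, sum_sgn_dotProduct]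
    rw [Finset.sum_eq_single 0]
    · simp [hf.map_zero]
    · intro y _ hy
      rw [if_neg fun h => hy (hB y h), mul_zero]
    · simp
  rw [Complex.conj_mul'] at h
  exact_mod_cast h

end IsQuadPhase

/-! ### Weyl operators -/

/-- The operator `X^a Z^b`. -/
def weyl (a b : Bits n) : Op n := Matrix.of fun x y => if x = y + a then sgn (b ⬝ᵥ y) else 0

/-- Exponent of `X` in a Pauli matrix. -/
def pauliX : Fin 4 → Fin 2 := ![0, 1, 1, 0]

/-- Exponent of `Z` in a Pauli matrix. -/
def pauliZ : Fin 4 → Fin 2 := ![0, 0, 1, 1]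

/-- Phase of a Pauli matrix relative to `X^a Z^b`. -/
noncomputable def pauliPhase : Fin 4 → ℂ := ![1, 1, Complex.I, 1]

/-- The Pauli matrix proportional to `X^a Z^b`. -/
def pauliIndex : Fin 2 → Fin 2 → Fin 4 := ![![0, 3], ![1, 2]]

theorem pauliX_pauliIndex (a b : Fin 2) : pauliX (pauliIndex a b) = a := by
  revert a b; decide

theorem pauliZ_pauliIndex (a b : Fin 2) : pauliZ (pauliIndex a b) = b := by
  revert a b; decide

theorem pauliPhase_pow_four (k : Fin 4) : pauliPhase k ^ 4 = 1 := by
  fin_cases k <;> simp [pauliPhase]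

theorem pauli_apply (k : Fin 4) (x y : Fin 2) :
    pauli k x y = pauliPhase k * if x = y + pauliX k then sgn (pauliZ k * y) else 0 := by
  fin_cases k <;> fin_cases x <;> fin_cases y <;> simp [pauli, pauliPhase, pauliX, pauliZ, sgn]

theorem pauliString_eq (s : Fin n → Fin 4) :
    pauliString s = (∏ q, pauliPhase (s q)) • weyl (pauliX ∘ s) (pauliZ ∘ s) := by
  ext x y
  simp only [pauliString, weyl, Matrix.smul_apply, Matrix.of_apply, pauli_apply,
    Finset.prod_mul_distrib, Finset.prod_ite_zero, smul_eq_mul, Finset.mem_univ, true_implies,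
    funext_iff, Pi.add_apply, Function.comp, dotProduct, sgn_sum]

theorem exists_weyl_eq_smul_pauliString (a b : Bits n) :
    ∃ (t : Fin n → Fin 4) (p : ℂ), p ^ 4 = 1 ∧ weyl a b = p • pauliString t := by
  set t : Fin n → Fin 4 := fun q => pauliIndex (a q) (b q) with ht
  have hp : (∏ q, pauliPhase (t q)) ^ 4 = 1 := by
    rw [← Finset.prod_pow]
    exact Finset.prod_eq_one fun q _ => pauliPhase_pow_four _
  have hne : ∏ q, pauliPhase (t q) ≠ 0 := by
    intro h
    simp [h] at hp
  refine ⟨t, (∏ q, pauliPhase (t q))⁻¹, by rw [inv_pow, hp, inv_one], ?_⟩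
  have ha : pauliX ∘ t = a := funext fun q => pauliX_pauliIndex _ _
  have hb : pauliZ ∘ t = b := funext fun q => pauliZ_pauliIndex _ _
  rw [pauliString_eq, smul_smul, inv_mul_cancel₀ hne, one_smul, ha, hb]

/-- Pauli strings are the operators X^a Z^b up to a fourth root of unity (a factor i for each Y), so
the Clifford property can be tested on the latter, whose exponents transform linearly. -/
theorem isClifford_of_weyl {V : UOp n}
    (h : ∀ a b : Bits n, ∃ (a' b' : Bits n) (p : ℂ), p ^ 4 = 1 ∧
      (V : Op n) * weyl a b * (V : Op n)ᴴ = p • weyl a' b') : IsClifford V := by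
  intro s
  obtain ⟨a', b', p, hp, hV⟩ := h (pauliX ∘ s) (pauliZ ∘ s)
  obtain ⟨t, p', hp', ht⟩ := exists_weyl_eq_smul_pauliString a' b'
  refine ⟨t, (∏ q, pauliPhase (s q)) * (p * p'), ?_, ?_⟩
  · rw [mul_pow, mul_pow, hp, hp', ← Finset.prod_pow,
      Finset.prod_eq_one fun q _ => pauliPhase_pow_four _]
    norm_num
  · rw [pauliString_eq, Matrix.mul_smul, Matrix.smul_mul, hV, ht, smul_smul, smul_smul, mul_assoc]

/-! ### The Walsh–Hadamard transform followed by a quadratic phase -/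

/-- The operator `H ⊗ ⋯ ⊗ H`. -/
noncomputable def walsh (n : ℕ) : Op n :=
  Matrix.of fun x y => ((1 / Real.sqrt 2 : ℝ) : ℂ) ^ n * sgn (x ⬝ᵥ y)

theorem walsh_apply (x y : Bits n) :
    walsh n x y = ((1 / Real.sqrt 2 : ℝ) : ℂ) ^ n * sgn (x ⬝ᵥ y) := rfl

theorem walsh_scale_mul_self (n : ℕ) :
    ((1 / Real.sqrt 2 : ℝ) : ℂ) ^ n * ((1 / Real.sqrt 2 : ℝ) : ℂ) ^ n = (1 / 2) ^ n := by
  rw [← mul_pow, ← Complex.ofReal_mul, div_mul_div_comm, Real.mul_self_sqrt (by norm_num)]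
  norm_num

theorem conjTranspose_walsh (n : ℕ) : (walsh n)ᴴ = walsh n := by
  ext x y
  simp only [walsh, Matrix.conjTranspose_apply, Matrix.of_apply, star_mul', star_sgn, star_pow,
    dotProduct_comm y x]
  congr 2
  exact Complex.conj_ofReal _

/-- Hadamards exchange X and Z. The sign comes from reordering Z^a X^b as X^b Z^a. -/
theorem walsh_mul_weyl_mul_walsh (a b : Bits n) :
    walsh n * weyl a b * walsh n = sgn (b ⬝ᵥ a) • weyl b a := by
  ext x y
  have h1 : ∀ w, (walsh n * weyl a b) x w
      = ((1 / Real.sqrt 2 : ℝ) : ℂ) ^ n * sgn (x ⬝ᵥ (w + a)) * sgn (b ⬝ᵥ w) := by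
    intro w
    rw [Matrix.mul_apply, Finset.sum_eq_single (w + a)]
    · simp [walsh, weyl]
    · intro z _ hz
      simp [weyl, hz]
    · simp
  rw [Matrix.mul_apply]
  have h2 : ∀ w, (walsh n * weyl a b) x w * walsh n w y
      = (1 / 2) ^ n * sgn (x ⬝ᵥ a) * sgn (w ⬝ᵥ (x + (y + b))) := by
    intro w
    rw [h1, walsh, Matrix.of_apply, ← walsh_scale_mul_self, dotProduct_add, dotProduct_add,
      dotProduct_add, sgn_add, sgn_add, sgn_add, dotProduct_comm x w, dotProduct_comm b w]
    ring
  simp only [h2, ← Finset.mul_sum, sum_sgn_dotProduct, bits_add_eq_zero_iff]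
  simp only [weyl,
    Matrix.smul_apply, Matrix.of_apply, smul_eq_mul]
  split_ifs with h
  · have h3 : ((1 / 2 : ℂ)) ^ n * 2 ^ n = 1 := by rw [← mul_pow]; norm_num
    rw [h, add_dotProduct, sgn_add, dotProduct_comm a y]
    linear_combination (sgn (y ⬝ᵥ a) * sgn (b ⬝ᵥ a)) * h3
  · simp

theorem weyl_zero_zero : (weyl 0 0 : Op n) = 1 := by
  ext x y
  simp [weyl, Matrix.one_apply]

theorem walsh_mul_self (n : ℕ) : walsh n * walsh n = 1 := by
  have := walsh_mul_weyl_mul_walsh (0 : Bits n) 0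
  rwa [weyl_zero_zero, mul_one, zero_dotProduct, sgn_zero, one_smul] at this

/-- The nonzero entries acquire the factor f(y + a) f̄(y). Polarization and |f(y)| = 1 reduce it to
f(a) times a sign linear in y, that is, a constant phase and a shift of the Z exponent. -/
theorem IsQuadPhase.diagonal_mul_weyl {f : Bits n → ℂ} {B : Matrix (Fin n) (Fin n) (Fin 2)}
    (hf : IsQuadPhase f B) (a b : Bits n) :
    Matrix.diagonal f * weyl a b * (Matrix.diagonal f)ᴴ = f a • weyl a (b + a ᵥ* B) := by
  ext x y
  rw [Matrix.diagonal_conjTranspose, Matrix.mul_diagonal, Matrix.diagonal_mul]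
  simp only [weyl, Matrix.of_apply, Matrix.smul_apply, smul_eq_mul, Pi.star_apply]
  split_ifs with h
  · rw [h, add_comm y a, hf.map_add, add_dotProduct, sgn_add, Matrix.dotProduct_mulVec]
    linear_combination (f a * sgn (a ᵥ* B ⬝ᵥ y) * sgn (b ⬝ᵥ y)) * hf.mul_star_self y
  · simp

theorem IsQuadPhase.mem_unitaryGroup {f : Bits n → ℂ} {B : Matrix (Fin n) (Fin n) (Fin 2)}
    (hf : IsQuadPhase f B) :
    Matrix.diagonal f * walsh n ∈ Matrix.unitaryGroup (Bits n) ℂ := by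
  rw [Matrix.mem_unitaryGroup_iff, Matrix.star_eq_conjTranspose, Matrix.conjTranspose_mul,
    conjTranspose_walsh, mul_assoc, ← mul_assoc (walsh n), walsh_mul_self, one_mul,
    Matrix.diagonal_conjTranspose, Matrix.diagonal_mul_diagonal, ← Matrix.diagonal_one]
  congr 1
  funext x
  exact hf.mul_star_self x

/-- The unitary which applies a Hadamard gate to every qubit and then a quadratic phase. -/
noncomputable def IsQuadPhase.unitary {f : Bits n → ℂ} {B : Matrix (Fin n) (Fin n) (Fin 2)}
    (hf : IsQuadPhase f B) : UOp n := ⟨Matrix.diagonal f * walsh n, hf.mem_unitaryGroup⟩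

theorem IsQuadPhase.isClifford_unitary {f : Bits n → ℂ}
    {B : Matrix (Fin n) (Fin n) (Fin 2)} (hf : IsQuadPhase f B) : IsClifford hf.unitary := by
  refine isClifford_of_weyl fun a b => ⟨b, a + b ᵥ* B, sgn (b ⬝ᵥ a) * f b, ?_, ?_⟩
  · have h : ∀ a : Fin 2, sgn a ^ 4 = 1 := by
      intro a
      fin_cases a <;> norm_num [sgn]
    rw [mul_pow, h, hf.pow_four, one_mul]
  · change Matrix.diagonal f * walsh n * weyl a b * (Matrix.diagonal f * walsh n)ᴴ = _
    rw [Matrix.conjTranspose_mul, conjTranspose_walsh]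
    calc _ = Matrix.diagonal f * (walsh n * weyl a b * walsh n) * (Matrix.diagonal f)ᴴ := by
          simp only [mul_assoc]
      _ = _ := by
          rw [walsh_mul_weyl_mul_walsh, Matrix.mul_smul, Matrix.smul_mul, hf.diagonal_mul_weyl,
            smul_smul]

/-- The overlap is 2⁻ⁿ times a Gauss sum with form B + C. The labels i, j enter only through a
linear sign, which leaves the form unchanged. The squared modulus is thus 4⁻ⁿ · 2ⁿ = 2⁻ⁿ. -/
theorem IsQuadPhase.mutuallyUnbiased_unitary {f g : Bits n → ℂ}
    {B C : Matrix (Fin n) (Fin n) (Fin 2)} (hf : IsQuadPhase f B) (hg : IsQuadPhase g C)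
    (hBC : ∀ y, (B + C) *ᵥ y = 0 → y = 0) :
    MutuallyUnbiased (basisVec hf.unitary) (basisVec hg.unitary) := by
  refine ⟨orthonormal_basisVec _, orthonormal_basisVec _, fun i j => ?_⟩
  have h1 := (hf.star.mul hg).mul (IsQuadPhase.linear (i + j))
  rw [add_zero] at h1
  have h2 : inner ℂ (basisVec hf.unitary i) (basisVec hg.unitary j)
      = (1 / 2) ^ n * ∑ x, (Star.star f * g * fun x => sgn (x ⬝ᵥ (i + j))) x := by
    rw [inner_basisVec, Matrix.mul_apply, Finset.mul_sum]
    refine Finset.sum_congr rfl fun x _ => ?_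
    simp only [IsQuadPhase.unitary, Matrix.conjTranspose_mul, conjTranspose_walsh,
      Matrix.diagonal_conjTranspose, Matrix.mul_diagonal, Matrix.diagonal_mul, walsh_apply,
      Pi.mul_apply, ← walsh_scale_mul_self, dotProduct_add, sgn_add, dotProduct_comm i x]
    ring
  rw [h2, norm_mul, mul_pow, h1.norm_sq_sum hBC, norm_pow, ← pow_mul, mul_comm n 2, pow_mul,
    ← mul_pow, ← one_div_pow]
  norm_num

theorem MutuallyUnbiased.symm {φ ψ : Bits n → EuclideanSpace ℂ (Bits n)}
    (h : MutuallyUnbiased φ ψ) : MutuallyUnbiased ψ φ :=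
  ⟨h.2.1, h.1, fun i j => by rw [norm_inner_symm, h.2.2]⟩

/-- A diagonal phase leaves all entries of H^{⊗n} at modulus 2^{-n/2}. -/
theorem IsQuadPhase.mutuallyUnbiased_one {f : Bits n → ℂ}
    {B : Matrix (Fin n) (Fin n) (Fin 2)} (hf : IsQuadPhase f B) :
    MutuallyUnbiased (basisVec 1) (basisVec hf.unitary) := by
  refine ⟨orthonormal_basisVec _, orthonormal_basisVec _, fun i j => ?_⟩
  have h : ∀ a : Fin 2, ‖sgn a‖ = 1 := by
    intro a
    fin_cases a <;> simp [sgn]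
  have h2 : ‖f i‖ = 1 := Complex.norm_eq_one_of_pow_eq_one (hf.pow_four i) (by norm_num)
  have h3 : ‖((1 / Real.sqrt 2 : ℝ) : ℂ)‖ ^ 2 = 1 / 2 := by
    rw [Complex.norm_real, Real.norm_eq_abs, sq_abs, div_pow, Real.sq_sqrt (by norm_num)]
    norm_num
  rw [inner_basisVec]
  simp only [OneMemClass.coe_one, Matrix.conjTranspose_one, one_mul, IsQuadPhase.unitary,
    Matrix.diagonal_mul, walsh, Matrix.of_apply, norm_mul, h, h2, mul_one, norm_pow]
  rw [← pow_mul, mul_comm n 2, pow_mul, h3, div_pow, one_pow]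

/-! ### The layer of Hadamard gates -/

/-- The tensor product of single-qubit operators. -/
def tensor (g : Fin n → Matrix (Fin 2) (Fin 2) ℂ) : Op n :=
  Matrix.of fun x y => ∏ q, g q (x q) (y q)

theorem tensor_mul (g h : Fin n → Matrix (Fin 2) (Fin 2) ℂ) :
    tensor g * tensor h = tensor fun q => g q * h q := by
  ext x y
  simp only [tensor, Matrix.mul_apply, Matrix.of_apply, ← Finset.prod_mul_distrib]
  rw [Finset.prod_univ_sum, Fintype.piFinset_univ]

theorem tensor_one : tensor (fun _ : Fin n => 1) = 1 := by
  ext x y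
  simp [tensor, Matrix.one_apply, Finset.prod_ite_zero, funext_iff]

theorem onQubit_eq_tensor (g : Matrix (Fin 2) (Fin 2) ℂ) (q : Fin n) :
    onQubit g q = tensor fun r => if r = q then g else 1 := by
  ext x y
  simp only [onQubit, tensor, Matrix.of_apply]
  rw [← Finset.mul_prod_erase _ _ (Finset.mem_univ q), if_pos rfl]
  have h : ∀ r ∈ Finset.univ.erase q, (if r = q then g else 1) (x r) (y r)
      = if x r = y r then (1 : ℂ) else 0 := by
    intro r hr
    rw [if_neg (Finset.ne_of_mem_erase hr), Matrix.one_apply]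
  rw [Finset.prod_congr rfl h, Finset.prod_ite_zero]
  simp only [Finset.mem_erase, Finset.mem_univ, and_true, Finset.prod_const_one, mul_ite, mul_one,
    mul_zero]

theorem prod_map_onQubit (g : Matrix (Fin 2) (Fin 2) ℂ) (l : List (Fin n)) (hl : l.Nodup) :
    (l.map (onQubit g)).prod = tensor fun r => if r ∈ l then g else 1 := by
  induction l with
  | nil => simp [tensor_one]
  | cons q l ih =>
    rw [List.nodup_cons] at hl
    rw [List.map_cons, List.prod_cons, ih hl.2, onQubit_eq_tensor, tensor_mul]
    congr 1
    funext r
    by_cases h : r = q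
    · subst h; simp [hl.1]
    · simp [h]

theorem tensor_hadamard :
    tensor (fun _ : Fin n => ((1 / Real.sqrt 2 : ℝ) : ℂ) • !![1, 1; 1, -1]) = walsh n := by
  ext x y
  have h : ∀ a b : Fin 2, (!![1, 1; 1, -1] : Matrix (Fin 2) (Fin 2) ℂ) a b = sgn (a * b) := by
    intro a b
    fin_cases a <;> fin_cases b <;> simp [sgn]
  simp only [tensor, Matrix.of_apply, Matrix.smul_apply, h, smul_eq_mul, Finset.prod_mul_distrib,
    Finset.prod_const, Finset.card_univ, Fintype.card_fin, walsh_apply, dotProduct, sgn_sum]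

/-- The layer of gates `g a` for `a ∈ s`. -/
noncomputable def layerOfFinset {ι : Type*} (s : Finset ι) (g : ι → Gate n)
    (h : ∀ a ∈ s, ∀ b ∈ s, a ≠ b → Disjoint (g a).support (g b).support) : Layer n where
  gates := s.toList.map g
  disjoint := by
    rw [List.pairwise_map]
    refine List.Pairwise.imp_of_mem ?_ s.nodup_toList
    intro a b ha hb hab
    exact h a (Finset.mem_toList.1 ha) b (Finset.mem_toList.1 hb) hab

/-- The layer applying a Hadamard gate to every qubit. -/
noncomputable def hadamardLayer (n : ℕ) : Layer n :=
  layerOfFinset Finset.univ Gate.H fun a _ b _ hab => by simpa [Gate.support] using hab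

theorem toOp_hadamardLayer (n : ℕ) : (hadamardLayer n).toOp = walsh n := by
  rw [Layer.toOp, hadamardLayer, layerOfFinset, List.map_map]
  change ((Finset.univ : Finset (Fin n)).toList.map (onQubit _)).prod = _
  rw [prod_map_onQubit _ _ (Finset.nodup_toList _)]
  simp only [Finset.mem_toList, Finset.mem_univ, if_true]
  exact tensor_hadamard

/-! ### Layers of diagonal gates -/

/-- The diagonal of a phase gate on qubit `q`. -/
noncomputable def phaseS (q : Fin n) (x : Bits n) : ℂ := if x q = 1 then Complex.I else 1

/-- The diagonal of a controlled-`Z` gate. -/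
noncomputable def phaseCZ (q r : Fin n) (x : Bits n) : ℂ := if x q = 1 ∧ x r = 1 then -1 else 1

theorem toOp_S (q : Fin n) : (Gate.S q).toOp = Matrix.diagonal (phaseS q) := by
  ext x y
  simp only [Gate.toOp, onQubit, Matrix.of_apply, Matrix.diagonal_apply, phaseS]
  by_cases hxy : x = y
  · subst hxy
    have h : ∀ a : Fin 2, (!![1, 0; 0, Complex.I] : Matrix (Fin 2) (Fin 2) ℂ) a a
        = if a = 1 then Complex.I else 1 := by
      intro a
      fin_cases a <;> simp
    rw [if_pos fun _ _ => rfl, if_pos rfl]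
    exact h _
  · rw [if_neg hxy]
    split_ifs with h
    · have hq : x q ≠ y q := by
        intro hq
        refine hxy (funext fun k => ?_)
        by_cases hk : k = q
        · rw [hk, hq]
        · exact h k hk
      have h2 : ∀ a b : Fin 2, a ≠ b →
          (!![1, 0; 0, Complex.I] : Matrix (Fin 2) (Fin 2) ℂ) a b = 0 := by
        intro a b hab
        fin_cases a <;> fin_cases b <;> simp at hab ⊢
      exact h2 _ _ hq
    · rfl

/-- Diagonal matrices commute, so the arbitrary order chosen by `Finset.toList` is harmless. -/
theorem toOp_layerOfFinset_of_diagonal {ι : Type*} (s : Finset ι) (g : ι → Gate n)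
    (h : ∀ a ∈ s, ∀ b ∈ s, a ≠ b → Disjoint (g a).support (g b).support)
    (f : ι → Bits n → ℂ) (hf : ∀ a, (g a).toOp = Matrix.diagonal (f a)) :
    (layerOfFinset s g h).toOp = Matrix.diagonal (∏ a ∈ s, f a) := by
  rw [Layer.toOp, layerOfFinset, List.map_map]
  have h1 : Gate.toOp ∘ g = Matrix.diagonalRingHom (Bits n) ℂ ∘ f := funext hf
  rw [h1, ← List.map_map, ← map_list_prod, Finset.prod_map_toList]
  rfl

theorem dotProduct_single_one_mulVec (x y : Bits n) (i j : Fin n) :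
    x ⬝ᵥ Matrix.single i j (1 : Fin 2) *ᵥ y = x i * y j := by
  rw [Matrix.single_mulVec, one_mul]
  exact dotProduct_single x (y j) i

/-- Bits add modulo 2 whereas powers of i add modulo 4. The carry, present only when both bits are
1, is the sign (-1)^{ab}. -/
theorem isQuadPhase_phaseS (q : Fin n) : IsQuadPhase (phaseS q) (Matrix.single q q 1) := by
  refine ⟨by simp [phaseS], fun x y => ?_⟩
  have h : ∀ a b : Fin 2, (if a + b = 1 then Complex.I else 1)
      = (if a = 1 then Complex.I else 1) * (if b = 1 then Complex.I else 1) * sgn (a * b) := by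
    intro a b
    fin_cases a <;> fin_cases b <;> simp [sgn]
  simp only [phaseS, Pi.add_apply, h, dotProduct_single_one_mulVec]

theorem phaseCZ_eq (q r : Fin n) (x : Bits n) : phaseCZ q r x = sgn (x q * x r) := by
  have h : ∀ a b : Fin 2, (if a = 1 ∧ b = 1 then (-1 : ℂ) else 1) = sgn (a * b) := by
    intro a b
    fin_cases a <;> fin_cases b <;> simp [sgn]
  exact h _ _

theorem isQuadPhase_phaseCZ (q r : Fin n) :
    IsQuadPhase (phaseCZ q r) (Matrix.single q r 1 + Matrix.single r q 1) := by
  refine ⟨by simp [phaseCZ], fun x y => ?_⟩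
  simp only [phaseCZ_eq, ← sgn_add, Pi.add_apply, Matrix.add_mulVec, dotProduct_add]
  congr 1
  rw [dotProduct_single_one_mulVec, dotProduct_single_one_mulVec]
  ring

/-! ### The circuit of a symmetric matrix over `𝔽₂` -/

/-- Pairs of qubits. -/
abbrev QubitPair (n : ℕ) : Type := {p : Fin n × Fin n // p.1 < p.2}

/-- The controlled-`Z` gate on a pair of qubits. -/
def QubitPair.gate (p : QubitPair n) : Gate n := .CZ p.1.1 p.1.2 p.2.ne

/-- The pairs joined by a symmetric matrix over `𝔽₂`. -/
def pairs (M : Matrix (Fin n) (Fin n) (Fin 2)) : Finset (QubitPair n) :=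
  Finset.univ.filter fun p => M p.1.1 p.1.2 = 1

/-- Edge colouring of the complete graph on the qubits. -/
def QubitPair.color (p : QubitPair n) : Fin n :=
  ⟨(p.1.1 + p.1.2 : ℕ) % n, Nat.mod_lt _ (Nat.zero_lt_of_lt p.1.1.2)⟩

theorem Fin.eq_of_add_mod_eq {a b c : Fin n} (h : (a + b : ℕ) % n = (a + c : ℕ) % n) : b = c :=
  Fin.ext (Nat.ModEq.eq_of_lt_of_lt (Nat.ModEq.add_left_cancel' (a : ℕ) h) b.2 c.2)

/-- With the colour a + b mod n, one endpoint and the colour determine the other endpoint, so each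
colour class is a matching. -/
theorem QubitPair.disjoint_support {p p' : QubitPair n} (hc : p.color = p'.color) (hne : p ≠ p') :
    Disjoint p.gate.support p'.gate.support := by
  obtain ⟨⟨a, b⟩, hab⟩ := p
  obtain ⟨⟨a', b'⟩, hab'⟩ := p'
  simp only [QubitPair.color, Fin.mk.injEq] at hc
  simp only [ne_eq, Subtype.mk.injEq, Prod.mk.injEq, not_and] at hne
  simp only at hab hab'
  simp only [QubitPair.gate, Gate.support, Finset.disjoint_insert_left, Finset.mem_insert,
    Finset.mem_singleton, Finset.disjoint_singleton_left, not_or]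
  refine ⟨⟨?_, ?_⟩, ?_, ?_⟩
  · rintro rfl
    exact hne rfl (Fin.eq_of_add_mod_eq hc)
  · rintro rfl
    rw [add_comm (a' : ℕ)] at hc
    have := Fin.eq_of_add_mod_eq hc
    subst this
    exact lt_asymm hab hab'
  · rintro rfl
    rw [add_comm (a : ℕ)] at hc
    have := Fin.eq_of_add_mod_eq hc
    subst this
    exact lt_asymm hab hab'
  · rintro rfl
    rw [add_comm (a : ℕ), add_comm (a' : ℕ)] at hc
    exact hne (Fin.eq_of_add_mod_eq hc) rfl

/-- The layer of controlled-`Z` gates of a given colour. -/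
noncomputable def czLayer (M : Matrix (Fin n) (Fin n) (Fin 2)) (c : Fin n) : Layer n :=
  layerOfFinset ((pairs M).filter fun p => p.color = c) QubitPair.gate fun _ hp _ hp' hne =>
    QubitPair.disjoint_support
      ((Finset.mem_filter.1 hp).2.trans (Finset.mem_filter.1 hp').2.symm) hne

/-- The layer of phase gates given by the diagonal. -/
noncomputable def phaseLayer (M : Matrix (Fin n) (Fin n) (Fin 2)) : Layer n :=
  layerOfFinset (Finset.univ.filter fun q => M q q = 1) Gate.S fun a _ b _ hab => by
    simpa [Gate.support] using hab

/-- The quadratic phase with polarization `M`. -/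
noncomputable def matrixPhase (M : Matrix (Fin n) (Fin n) (Fin 2)) : Bits n → ℂ :=
  (∏ q with M q q = 1, phaseS q) *
    ∏ c, ∏ p ∈ (pairs M).filter fun p => p.color = c, phaseCZ p.1.1 p.1.2

/-- The circuit preparing the basis associated with a symmetric matrix over `𝔽₂`. -/
noncomputable def matrixCircuit (M : Matrix (Fin n) (Fin n) (Fin 2)) : Circuit n :=
  hadamardLayer n :: phaseLayer M :: Finset.univ.toList.map (czLayer M)

/-- One layer of H, one of S and one per colour. Empty layers are counted too. -/
theorem depth_matrixCircuit (M : Matrix (Fin n) (Fin n) (Fin 2)) :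
    (matrixCircuit M).depth = n + 2 := by
  simp [Circuit.depth, matrixCircuit]

theorem toOp_map_of_diagonal {ι : Type*} (l : List ι) (L : ι → Layer n) (f : ι → Bits n → ℂ)
    (hf : ∀ a, (L a).toOp = Matrix.diagonal (f a)) :
    Circuit.toOp (l.map L) = Matrix.diagonal (l.map f).prod := by
  induction l with
  | nil => exact Matrix.diagonal_one.symm
  | cons a l ih =>
    rw [List.map_cons, Circuit.toOp, ih, hf, List.map_cons, List.prod_cons,
      Matrix.diagonal_mul_diagonal, mul_comm]
    rfl

theorem toOp_gate (p : QubitPair n) :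
    p.gate.toOp = Matrix.diagonal (phaseCZ p.1.1 p.1.2) := rfl

theorem toOp_czLayer (M : Matrix (Fin n) (Fin n) (Fin 2)) (c : Fin n) :
    (czLayer M c).toOp = Matrix.diagonal
      (∏ p ∈ (pairs M).filter fun p => p.color = c, phaseCZ p.1.1 p.1.2) := by
  rw [czLayer, toOp_layerOfFinset_of_diagonal _ _ _ _ toOp_gate]

theorem toOp_matrixCircuit (M : Matrix (Fin n) (Fin n) (Fin 2)) :
    Circuit.toOp (matrixCircuit M) = Matrix.diagonal (matrixPhase M) * walsh n := by
  rw [matrixCircuit, Circuit.toOp, Circuit.toOp, toOp_hadamardLayer, phaseLayer,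
    toOp_layerOfFinset_of_diagonal _ _ _ _ toOp_S,
    toOp_map_of_diagonal _ _ _ (toOp_czLayer M),
    Finset.prod_map_toList, Matrix.diagonal_mul_diagonal, matrixPhase, mul_comm (∏ q with _, _)]
  rfl

theorem sum_single_eq_of_isSymm {M : Matrix (Fin n) (Fin n) (Fin 2)} (hM : M.IsSymm) :
    (∑ q with M q q = 1, Matrix.single q q 1) + ∑ c, ∑ p ∈ (pairs M).filter fun p => p.color = c,
      (Matrix.single p.1.1 p.1.2 1 + Matrix.single p.1.2 p.1.1 1) = M := by
  have hite : ∀ a : Fin 2, (if a = 1 then (1 : Fin 2) else 0) = a := by decide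
  -- The colour classes partition the pairs, so the double sum collapses to one over all pairs. Only
  -- entries above the diagonal are read, and symmetry of M supplies those below.
  rw [Finset.sum_fiberwise, pairs, Finset.sum_filter, Finset.sum_filter]
  ext i j
  have hdiag : (∑ q, if M q q = 1 then Matrix.single q q (1 : Fin 2) else 0) i j
      = if i = j then M i j else 0 := by
    rw [Matrix.sum_apply, Finset.sum_eq_single i]
    · by_cases hij : i = j
      · subst hij
        rw [if_pos rfl, ← hite (M i i)]
        split_ifs <;> simp_all
      · rw [if_neg hij]
        split_ifs <;> simp [hij]
    · intro q _ hq
      split_ifs <;> simp [hq]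
    · simp
  have hoff : ∀ i j : Fin n, i < j → ∀ k l : Fin n, (k = i ∧ l = j ∨ k = j ∧ l = i) →
      (∑ p : QubitPair n, if M p.1.1 p.1.2 = 1 then
        (Matrix.single p.1.1 p.1.2 (1 : Fin 2) + Matrix.single p.1.2 p.1.1 1) else 0 :
        Matrix (Fin n) (Fin n) (Fin 2)) k l
        = M i j := by
    intro i j hij k l hkl
    rw [Matrix.sum_apply, Finset.sum_eq_single ⟨(i, j), hij⟩]
    · rw [← hite (M i j)]
      rcases hkl with ⟨rfl, rfl⟩ | ⟨rfl, rfl⟩ <;> split_ifs <;>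
        simp_all [hij.ne, hij.ne']
    · rintro ⟨⟨a, b⟩, hab⟩ _ hne
      simp only [ne_eq, Subtype.mk.injEq, Prod.mk.injEq] at hne hab
      split_ifs
      · simp only [Matrix.add_apply, Matrix.single_apply]
        rw [if_neg, if_neg, add_zero] <;> omega
      · rfl
    · simp
  have hzero : ∀ i : Fin n, (∑ p : QubitPair n, if M p.1.1 p.1.2 = 1 then
        (Matrix.single p.1.1 p.1.2 (1 : Fin 2) + Matrix.single p.1.2 p.1.1 1) else 0 :
        Matrix (Fin n) (Fin n) (Fin 2)) i i = 0 := by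
    intro i
    rw [Matrix.sum_apply]
    refine Finset.sum_eq_zero ?_
    rintro ⟨⟨a, b⟩, hab⟩ _
    simp only at hab
    split_ifs
    · simp only [Matrix.add_apply, Matrix.single_apply]
      rw [if_neg, if_neg, add_zero] <;> omega
    · rfl
  rw [Matrix.add_apply, hdiag]
  rcases lt_trichotomy i j with h | h | h
  · rw [if_neg h.ne, hoff i j h i j (Or.inl ⟨rfl, rfl⟩), zero_add]
  · subst h
    rw [if_pos rfl, hzero, add_zero]
  · rw [if_neg h.ne', hoff j i h i j (Or.inr ⟨rfl, rfl⟩), zero_add, hM.apply]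

theorem isQuadPhase_matrixPhase {M : Matrix (Fin n) (Fin n) (Fin 2)} (hM : M.IsSymm) :
    IsQuadPhase (matrixPhase M) M := by
  have h := (IsQuadPhase.prod (Finset.univ.filter fun q => M q q = 1) isQuadPhase_phaseS).mul
    (IsQuadPhase.prod Finset.univ fun c : Fin n =>
      IsQuadPhase.prod ((pairs M).filter fun p => p.color = c)
        fun p => isQuadPhase_phaseCZ p.1.1 p.1.2)
  rwa [sum_single_eq_of_isSymm hM] at h

theorem hasCliffordCircuit_matrixPhase {M : Matrix (Fin n) (Fin n) (Fin 2)} (hM : M.IsSymm) :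
    HasCliffordCircuit (isQuadPhase_matrixPhase hM).unitary (n + 2) :=
  ⟨(isQuadPhase_matrixPhase hM).isClifford_unitary, matrixCircuit M,
    (depth_matrixCircuit M).le, toOp_matrixCircuit M⟩

/-- Mutually unbiased bases generated by shallow Clifford circuits. -/
theorem exists_mapsToMUBs_hasCliffordCircuit (hn : 1 ≤ n) :
    ∃ U : Fin (2 ^ n) → UOp n, MapsToMUBs U ∧ ∀ i, HasCliffordCircuit (U i) (n + 2) := by
  obtain ⟨M, hM, hspread⟩ := exists_symmetric_spread n (by omega)
  refine ⟨fun i => (isQuadPhase_matrixPhase (hM i)).unitary, ?_,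
    fun i => hasCliffordCircuit_matrixPhase (hM i)⟩
  intro i k hik
  induction i using Fin.lastCases with
  | cast i =>
    induction k using Fin.lastCases with
    | cast k =>
      simp only [Fin.snoc_castSucc]
      exact (isQuadPhase_matrixPhase (hM i)).mutuallyUnbiased_unitary
        (isQuadPhase_matrixPhase (hM k)) (hspread i k fun h => hik (h ▸ rfl))
    | last =>
      simp only [Fin.snoc_castSucc, Fin.snoc_last]
      exact (isQuadPhase_matrixPhase (hM i)).mutuallyUnbiased_one.symm
  | last =>
    induction k using Fin.lastCases with
    | cast k =>
      simp only [Fin.snoc_castSucc, Fin.snoc_last]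
      exact (isQuadPhase_matrixPhase (hM k)).mutuallyUnbiased_one
    | last => exact absurd rfl hik

end WireCut

theorem theorem2 (n : ℕ) (hn : 1 ≤ n) :
    (∀ U : Fin (2 ^ n) → WireCut.UOp n, WireCut.MapsToMUBs U →
      (∀ A : WireCut.Op n,
        A = (∑ i : Fin (2 ^ n), ∑ j : WireCut.Bits n,
              (WireCut.rotKetbra (U i) j * A).trace • WireCut.rotKetbra (U i) j)
            - ((2 : ℂ) ^ n - 1) • ∑ j : WireCut.Bits n,
              (WireCut.ketbra j * A).trace • WireCut.rhoOther j) ∧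
      WireCut.IsQuasiprobDecomposition LinearMap.id (WireCut.cutCoeffs n)
        (WireCut.cutChannels U) ∧
      Function.Injective (WireCut.cutChannels U) ∧
      WireCut.gamma (WireCut.cutCoeffs n) = 2 ^ (n + 1) - 1) ∧
    ∃ U : Fin (2 ^ n) → WireCut.UOp n, WireCut.MapsToMUBs U ∧
      ∀ i, WireCut.HasCliffordCircuit (U i) (n + 2) := by
  exact ⟨fun _ hU => ⟨hU.identity_eq hn, hU.isQuasiprobDecomposition hn,
    hU.cutChannels_injective hn, WireCut.gamma_cutCoeffs n⟩,
    WireCut.exists_mapsToMUBs_hasCliffordCircuit hn⟩
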